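/- Let $n\in\mathbb N$ and let $g:\mathbb R^n\to\mathbb R\cup\{+\infty\}$ be a convex function such that $Z=\int_{\mathbb R^n}e^{-g(x)}\,dx$ satisfies $0<Z<\infty$ (with $e^{-\infty}=0$), so that $p(x)=e^{-g(x)}/Z$ is a log-concave probability density on $\mathbb R^n$ (for instance a posterior density $p(x\mid y)$, with $g=g_y$ for a fixed observation $y$). Let $P$ be the probability measure with density $p$ with respect to Lebesgue measure. Let $\hat x_{MAP}\in\operatorname{argmin}_{x\in\mathbb R^n}g(x)$ be a maximum-a-posteriori estimator. Let $\alpha\in(4e^{-n/3},1)$, and set $$\tau_\alpha=\sqrt{\frac{16\log(3/\alpha)}{n}},\qquad \tilde C_\alpha=\{x\in\mathbb R^n: g(x)\le g(\hat x_{MAP})+n(\tau_\alpha+1)\}.$$ Then $\tau_\alpha>0$, and: 1. for every $\gamma_\alpha\in\mathbb R$ such that the region $C^*_\alpha=\{x\in\mathbb R^n: g(x)\le\gamma_\alpha\}$ satisfies $P(C^*_\alpha)=1-\alpha$ (that is, $C^*_\alpha$ is the highest-posterior-density region of level $1-\alpha$), one has $C^*_\alpha\subseteq\tilde C_\alpha$;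 2. $P(\tilde C_\alpha)\ge 1-\alpha$. -/

import Mathlib

open MeasureTheory Set
open scoped ENNReal

noncomputable section

namespace HPD

/-- Convexity of an extended-real-valued function on `ℝⁿ`: its epigraph is a convex set. The value
`+∞` is allowed, so that convex constraints can be encoded in the function. -/
def EConvex {n : ℕ} (g : EuclideanSpace ℝ (Fin n) → EReal) : Prop :=
  Convex ℝ {q : EuclideanSpace ℝ (Fin n) × ℝ | g q.1 ≤ (q.2 : EReal)}

/-- The normalising constant `Z = ∫ exp (-g x) dx` (with `exp (-∞) = 0`). -/
def normConst {n : ℕ} (g : EuclideanSpace ℝ (Fin n) → EReal) : ℝ≥0∞ :=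
  ∫⁻ x, EReal.exp (-g x)

/-- The posterior density `p x = exp (-g x) / Z`. -/
def density {n : ℕ} (g : EuclideanSpace ℝ (Fin n) → EReal) (x : EuclideanSpace ℝ (Fin n)) : ℝ≥0∞ :=
  EReal.exp (-g x) / normConst g

/-- The posterior distribution: the measure with density `p` with respect to Lebesgue measure. -/
def posterior {n : ℕ} (g : EuclideanSpace ℝ (Fin n) → EReal) :
    Measure (EuclideanSpace ℝ (Fin n)) :=
  volume.withDensity (density g)

/-- `p = exp (-g) / Z` is a log-concave probability density: `g` is convex with values in
`ℝ ∪ {+∞}`, and the normalising constant is positive and finite. -/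
structure IsLogConcave {n : ℕ} (g : EuclideanSpace ℝ (Fin n) → EReal) : Prop where
  ne_bot : ∀ x, g x ≠ ⊥
  convex : EConvex g
  normConst_ne_zero : normConst g ≠ 0
  normConst_ne_top : normConst g ≠ ∞

/-- `x` is a maximum-a-posteriori estimator: a global minimiser of `g`. -/
def IsMAP {n : ℕ} (g : EuclideanSpace ℝ (Fin n) → EReal) (x : EuclideanSpace ℝ (Fin n)) : Prop :=
  IsMinOn g univ x

/-- The region `{x : g x ≤ γ}`. -/
def region {n : ℕ} (g : EuclideanSpace ℝ (Fin n) → EReal) (γ : ℝ) :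
    Set (EuclideanSpace ℝ (Fin n)) :=
  {x | g x ≤ (γ : EReal)}

/-- `γ` is a threshold of the highest-posterior-density region of level `1 - α`: the region
`{x : g x ≤ γ}` has posterior probability exactly `1 - α`. -/
def IsHPDThreshold {n : ℕ} (g : EuclideanSpace ℝ (Fin n) → EReal) (α γ : ℝ) : Prop :=
  posterior g (region g γ) = ENNReal.ofReal (1 - α)

/-- The constant `τ_α = √(16 log (3 / α) / n)`. -/
def tau (n : ℕ) (α : ℝ) : ℝ :=
  Real.sqrt (16 * Real.log (3 / α) / n)

/-- The bounding set `{x : g x ≤ g x_MAP + n (τ_α + 1)}`. -/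
def boundingSet {n : ℕ} (g : EuclideanSpace ℝ (Fin n) → EReal) (xMAP : EuclideanSpace ℝ (Fin n))
    (α : ℝ) : Set (EuclideanSpace ℝ (Fin n)) :=
  {x | g x ≤ g xMAP + ((n * (tau n α + 1) : ℝ) : EReal)}

end HPD

end

/-! The idea is a Chernoff bound for `g` under the posterior, which for a convex `g` can be computed
by a change of variables. Let `m = g xMAP` be the minimum of `g`, let `t ≥ 0` and `c = 1 / (1 + t)`,
and let `h` be the homothety of ratio `c` centred at `xMAP`. Convexity gives
`g (h x) ≤ m + c (g x - m)`, so where `g x > m + n (1 + t)` one has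
`g x ≥ g (h x) + (1 - c) n (1 + t) = g (h x) + n t`. Integrating `exp (-g)` over that set and
rescaling, which costs the factor `c⁻ⁿ = (1 + t)ⁿ`, bounds its posterior probability by
`((1 + t) exp (-t))ⁿ` (`posterior_compl_region_le`).

The lower bound on `α` amounts to `τ_α ^ 2 < 16 / 3`, and in this range
`1 + t ≤ exp (t - t ^ 2 / 16)` (`one_add_le_exp_sub_sq`); hence the bounding set misses at most mass
`exp (-n τ_α ^ 2 / 16) = α / 3`. This is strictly less than `α`, so a region `{g ≤ γ}` of mass
exactly `1 - α` cannot contain the bounding set; the two sets are nested since both are sublevel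
sets of `g`, and so the region lies in the bounding set. -/

namespace HPD

open Module

/-! ### Change of variables and sublevel sets -/

/-- Lebesgue integrals scale under the homothety of ratio `c` centred at `a`. No measurability of
`f` is needed. -/
lemma lintegral_comp_homothety {E : Type*} [NormedAddCommGroup E] [NormedSpace ℝ E]
    [MeasurableSpace E] [BorelSpace E] [FiniteDimensional ℝ E] (μ : Measure E)
    [μ.IsAddHaarMeasure] (f : E → ℝ≥0∞) (a : E) {c : ℝ} (hc : c ≠ 0) :
    ∫⁻ x, f (c • (x - a) + a) ∂μ = ENNReal.ofReal |(c ^ finrank ℝ E)⁻¹| * ∫⁻ x, f x ∂μ := by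
  rw [lintegral_sub_right_eq_self (fun x => f (c • x + a)) a,
    ← lintegral_add_right_eq_self f a, ← smul_eq_mul, ← lintegral_smul_measure,
    ← Measure.map_addHaar_smul μ hc]
  exact (lintegral_map_equiv (fun x => f (x + a)) (MeasurableEquiv.smul₀ c hc)).symm

variable {n : ℕ} {g : EuclideanSpace ℝ (Fin n) → EReal}

lemma EConvex.convex_region (hg : EConvex g) (γ : ℝ) : Convex ℝ (region g γ) := by
  intro x hx y hy a b ha hb hab
  have h := hg (x := (x, γ)) hx (y := (y, γ)) hy ha hb hab
  have hγ : a * γ + b * γ = γ := by rw [← add_mul, hab, one_mul]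
  simpa [region, hγ] using h

/-- Along the segment from `a` to `x`, a convex `g` lies below its chord. -/
lemma EConvex.apply_homothety_le (hg : EConvex g) {a x : EuclideanSpace ℝ (Fin n)} {m r c : ℝ}
    (ha : g a = m) (hx : g x = r) (hc₀ : 0 ≤ c) (hc₁ : c ≤ 1) :
    g (c • (x - a) + a) ≤ ((m + c * (r - m) : ℝ) : EReal) := by
  have h := hg (x := (x, r)) hx.le (y := (a, m)) ha.le hc₀ (sub_nonneg.2 hc₁) (by ring)
  have h₁ : c • x + (1 - c) • a = c • (x - a) + a := by module
  have h₂ : c * r + (1 - c) * m = m + c * (r - m) := by ring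
  simpa only [mem_ofPred_eq, Prod.smul_mk, Prod.mk_add_mk, smul_eq_mul, h₁, h₂] using h

/-! ### The posterior -/

lemma posterior_apply (hg : IsLogConcave g) (s : Set (EuclideanSpace ℝ (Fin n))) :
    posterior g s = (∫⁻ x in s, EReal.exp (-g x)) / normConst g := by
  simp only [posterior, density, withDensity_apply', div_eq_mul_inv]
  exact lintegral_mul_const' _ _ (ENNReal.inv_ne_top.2 hg.normConst_ne_zero)

lemma posterior_univ (hg : IsLogConcave g) : posterior g univ = 1 := by
  rw [posterior_apply hg, Measure.restrict_univ]
  exact ENNReal.div_self hg.normConst_ne_zero hg.normConst_ne_top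

/-- The minimum of `g` is finite, because `g` is not identically `+∞`. -/
lemma IsMAP.exists_apply_eq_coe {a : EuclideanSpace ℝ (Fin n)} (ha : IsMAP g a)
    (hg : IsLogConcave g) : ∃ m : ℝ, g a = m := by
  refine ⟨(g a).toReal, (EReal.coe_toReal (fun htop => ?_) (hg.ne_bot a)).symm⟩
  refine hg.normConst_ne_zero ?_
  have h : ∀ x, g x = ⊤ := fun x => top_le_iff.1 (htop ▸ ha (mem_univ x))
  simp [normConst, h]

/-- The Chernoff bound for `g` under the posterior. -/
lemma posterior_compl_region_le (hg : IsLogConcave g) {a : EuclideanSpace ℝ (Fin n)} {m t : ℝ}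
    (ha : g a = m) (ht : 0 ≤ t) :
    posterior g (region g (m + n * (t + 1)))ᶜ ≤
      ENNReal.ofReal (((1 + t) * Real.exp (-t)) ^ n) := by
  set c : ℝ := (1 + t)⁻¹ with hc
  have ht₁ : 0 < 1 + t := by linarith
  have hc₀ : 0 < c := inv_pos.2 ht₁
  have hc₁ : c ≤ 1 := inv_le_one_of_one_le₀ (by linarith)
  have hct : (1 - c) * (n * (t + 1)) = n * t := by
    rw [hc]; field_simp; ring
  have key : ∀ x ∈ (region g (m + n * (t + 1)))ᶜ, EReal.exp (-g x) ≤
      ENNReal.ofReal (Real.exp (-(n * t))) * EReal.exp (-g (c • (x - a) + a)) := by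
    intro x hx
    have hx' : ((m + n * (t + 1) : ℝ) : EReal) < g x := not_le.1 hx
    rcases eq_or_ne (g x) ⊤ with htop | htop
    · simp [htop]
    lift g x to ℝ using ⟨htop, hg.ne_bot x⟩ with r hr
    rw [EReal.coe_lt_coe_iff] at hx'
    have hle := hg.convex.apply_homothety_le ha hr.symm hc₀.le hc₁
    calc EReal.exp (-(r : EReal))
        ≤ ENNReal.ofReal (Real.exp (-(n * t))) * EReal.exp (-((m + c * (r - m) : ℝ) : EReal)) := by
          rw [← EReal.coe_neg, ← EReal.coe_neg, EReal.exp_coe, EReal.exp_coe,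
            ← ENNReal.ofReal_mul (Real.exp_pos _).le, ← Real.exp_add]
          refine ENNReal.ofReal_le_ofReal (Real.exp_le_exp.2 ?_)
          have := mul_le_mul_of_nonneg_left (show n * (t + 1) ≤ r - m by linarith)
            (sub_nonneg.2 hc₁)
          linarith
      _ ≤ _ := by
          gcongr
          exact EReal.neg_le_neg_iff.2 hle
  have hmeas : NullMeasurableSet (region g (m + n * (t + 1)))ᶜ
      (volume : Measure (EuclideanSpace ℝ (Fin n))) :=
    ((hg.convex.convex_region _).nullMeasurableSet volume).compl
  rw [posterior_apply hg]
  refine ENNReal.div_le_of_le_mul ?_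
  calc ∫⁻ x in (region g (m + n * (t + 1)))ᶜ, EReal.exp (-g x)
      ≤ ∫⁻ x in (region g (m + n * (t + 1)))ᶜ,
          ENNReal.ofReal (Real.exp (-(n * t))) * EReal.exp (-g (c • (x - a) + a)) :=
        lintegral_mono_ae ((ae_restrict_mem₀ hmeas).mono key)
    _ ≤ ∫⁻ x, ENNReal.ofReal (Real.exp (-(n * t))) * EReal.exp (-g (c • (x - a) + a)) :=
        setLIntegral_le_lintegral _ _
    _ = ENNReal.ofReal (((1 + t) * Real.exp (-t)) ^ n) * normConst g := by
        rw [lintegral_const_mul' _ _ ENNReal.ofReal_ne_top,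
          lintegral_comp_homothety volume (fun x => EReal.exp (-g x)) a hc₀.ne', ← mul_assoc,
          ← ENNReal.ofReal_mul (Real.exp_pos _).le, finrank_euclideanSpace_fin, hc, inv_pow,
          inv_inv, abs_of_pos (pow_pos ht₁ n), mul_pow, ← Real.exp_nat_mul, mul_neg, mul_comm,
          mul_comm (Real.exp _), mul_comm, normConst]

/-! ### The constant `τ_α` -/

/-- A weak form of `log (1 + t) ≤ t - t ^ 2 / 16`, obtained by keeping the quadratic term of the
exponential series. -/
lemma one_add_le_exp_sub_sq {t : ℝ} (ht : 0 ≤ t) (ht' : t ≤ 4) :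
    1 + t ≤ Real.exp (t - t ^ 2 / 16) := by
  have h := Real.quadratic_le_exp_of_nonneg (x := t - t ^ 2 / 16) (by nlinarith)
  -- The quadratic lower bound exceeds `1 + t` by `t ^ 2 ((1 - t / 16) ^ 2 / 2 - 1 / 16)`.
  have h' : 0 ≤ t ^ 2 * ((1 - t / 16) ^ 2 / 2 - 1 / 16) :=
    mul_nonneg (sq_nonneg t) (by nlinarith)
  nlinarith

lemma tau_bounds {α : ℝ} (hα : α ∈ Ioo (4 * Real.exp (-(n : ℝ) / 3)) 1) :
    0 < tau n α ∧ tau n α ≤ 4 ∧ n * (tau n α ^ 2 / 16) = Real.log (3 / α) := by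
  obtain ⟨hα₁, hα₂⟩ := hα
  have hα₀ : 0 < α := lt_trans (by positivity) hα₁
  have hn : (0 : ℝ) < n := by
    rcases Nat.eq_zero_or_pos n with rfl | hn
    · norm_num at hα₁
      linarith
    · exact_mod_cast hn
  have hlog : 0 < Real.log (3 / α) := Real.log_pos (by rw [lt_div_iff₀ hα₀]; linarith)
  have hlog' : Real.log (3 / α) ≤ n / 3 := by
    rw [Real.log_le_iff_le_exp (by positivity), div_le_iff₀ hα₀]
    have h : Real.exp (n / 3) * Real.exp (-(n : ℝ) / 3) = 1 := by
      rw [← Real.exp_add, neg_div, add_neg_cancel, Real.exp_zero]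
    nlinarith [mul_lt_mul_of_pos_left hα₁ (Real.exp_pos ((n : ℝ) / 3))]
  refine ⟨Real.sqrt_pos.2 (by positivity), Real.sqrt_le_iff.2 ⟨by norm_num, ?_⟩, ?_⟩
  · rw [div_le_iff₀ hn]
    linarith
  · rw [tau, Real.sq_sqrt (by positivity)]
    field_simp

lemma chernoff_tau_lt {α : ℝ} (hα : α ∈ Ioo (4 * Real.exp (-(n : ℝ) / 3)) 1) :
    ((1 + tau n α) * Real.exp (-tau n α)) ^ n < α := by
  obtain ⟨h₀, h₄, heq⟩ := tau_bounds hα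
  have hα₀ : 0 < α := lt_trans (by positivity) hα.1
  calc ((1 + tau n α) * Real.exp (-tau n α)) ^ n
      ≤ (Real.exp (tau n α - tau n α ^ 2 / 16) * Real.exp (-tau n α)) ^ n := by
        gcongr
        exact one_add_le_exp_sub_sq h₀.le h₄
    _ = Real.exp (-Real.log (3 / α)) := by
        rw [← Real.exp_add, ← Real.exp_nat_mul, ← heq]
        ring_nf
    _ = α / 3 := by rw [Real.exp_neg, Real.exp_log (by positivity), inv_div]
    _ < α := by linarith

/-- The bounding set has mass strictly larger than `1 - α`. -/
lemma lt_posterior_boundingSet (hg : IsLogConcave g) {a : EuclideanSpace ℝ (Fin n)}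
    (ha : IsMAP g a) {α : ℝ} (hα : α ∈ Ioo (4 * Real.exp (-(n : ℝ) / 3)) 1) :
    ENNReal.ofReal (1 - α) < posterior g (boundingSet g a α) := by
  obtain ⟨m, hm⟩ := ha.exists_apply_eq_coe hg
  have hα₀ : 0 < α := lt_trans (by positivity) hα.1
  have hset : boundingSet g a α = region g (m + n * (tau n α + 1)) := by
    simp only [boundingSet, region, hm, EReal.coe_add]
  have htail : posterior g (boundingSet g a α)ᶜ < ENNReal.ofReal α := by
    rw [hset]
    exact (posterior_compl_region_le hg hm (tau_bounds hα).1.le).trans_lt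
      ((ENNReal.ofReal_lt_ofReal_iff hα₀).2 (chernoff_tau_lt hα))
  have htotal : 1 ≤ posterior g (boundingSet g a α) + posterior g (boundingSet g a α)ᶜ := by
    rw [← posterior_univ hg, ← union_compl_self (boundingSet g a α)]
    exact measure_union_le _ _
  by_contra! hle
  refine absurd htotal (not_le.2 ?_)
  calc posterior g (boundingSet g a α) + posterior g (boundingSet g a α)ᶜ
      < ENNReal.ofReal (1 - α) + ENNReal.ofReal α :=
        ENNReal.add_lt_add_of_le_of_lt (hle.trans_lt ENNReal.ofReal_lt_top).ne hle htail
    _ = 1 := by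
        rw [← ENNReal.ofReal_add (sub_nonneg.2 hα.2.le) hα₀.le, sub_add_cancel, ENNReal.ofReal_one]

end HPD

theorem theorem1 {n : ℕ} (g : EuclideanSpace ℝ (Fin n) → EReal) (hg : HPD.IsLogConcave g)
    (xMAP : EuclideanSpace ℝ (Fin n)) (hMAP : HPD.IsMAP g xMAP)
    (α : ℝ) (hα : α ∈ Set.Ioo (4 * Real.exp (-(n : ℝ) / 3)) 1) :
    0 < HPD.tau n α ∧
    (∀ γ : ℝ, HPD.IsHPDThreshold g α γ → HPD.region g γ ⊆ HPD.boundingSet g xMAP α) ∧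
    ENNReal.ofReal (1 - α) ≤ HPD.posterior g (HPD.boundingSet g xMAP α) := by
  have hlt := HPD.lt_posterior_boundingSet hg hMAP hα
  refine ⟨(HPD.tau_bounds hα).1, fun γ hγ x hx => ?_, hlt.le⟩
  by_contra hxB
  -- Then `γ` exceeds the bounding level, so the region contains the bounding set: too much mass.
  have hsub : HPD.boundingSet g xMAP α ⊆ HPD.region g γ := fun y hy =>
    (show g y ≤ _ from hy).trans ((not_le.1 hxB).le.trans (show g x ≤ γ from hx))
  exact absurd (measure_mono hsub) (not_le.2 (hγ.trans_lt hlt))
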